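/- Let $G$ be a compact Abelian topological group, written additively. Let $\mathcal C(G)$ be the space of all continuous functions $f:G\to\mathbb C$, with the topology of uniform convergence on compact sets (on the compact group $G$ this is just uniform convergence). A \emph{variety} on $G$ is a closed linear subspace $V$ of $\mathcal C(G)$ such that for each $f\in V$ and $y\in G$ the translate $x\mapsto f(x+y)$ belongs to $V$. An \emph{exponential} is a continuous homomorphism of $G$ into the multiplicative group of nonzero complex numbers, and an \emph{additive function} is a continuous homomorphism of $G$ into the additive group of complex numbers. An \emph{exponential monomial} is a function of the form $$f(x)=P\big(a_1(x),a_2(x),\dots,a_k(x)\big)\,m(x),$$ where $P$ is a complex polynomial in $k$ variables, $a_1,\dots,a_k$ are additive functions and $m$ is an exponential. Then spectral synthesis holds on $G$; that is, for every variety $V$ on $G$, the exponential monomials belonging to $V$ span a dense linear subspace of $V$. -/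

import Mathlib

namespace SpectralSynthesis

section

variable {G : Type*} [AddCommGroup G] [TopologicalSpace G]

/-- The translate `τ_y f` of a continuous function: `(τ_y f)(x) = f (x + y)`. -/
noncomputable def translateMap [IsTopologicalAddGroup G] (y : G) (f : C(G, ℂ)) : C(G, ℂ) :=
  ⟨fun x => f (x + y), by fun_prop⟩

/-- A variety: a closed translation invariant linear subspace of `C(G, ℂ)`, where `C(G, ℂ)`
carries the topology of uniform convergence on compact sets. -/
structure IsVariety [IsTopologicalAddGroup G] (V : Submodule ℂ C(G, ℂ)) : Prop where
  isClosed : IsClosed (V : Set C(G, ℂ))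
  translate_mem : ∀ (y : G), ∀ f ∈ V, translateMap y f ∈ V

/-- An exponential: a continuous homomorphism of `G` into the multiplicative group of nonzero
complex numbers. -/
structure IsExponential (m : C(G, ℂ)) : Prop where
  ne_zero : ∀ x, m x ≠ 0
  map_add : ∀ x y, m (x + y) = m x * m y

/-- An additive function: a continuous homomorphism of `G` into the additive group of complex
numbers. -/
def IsAdditive (a : C(G, ℂ)) : Prop :=
  ∀ x y, a (x + y) = a x + a y

/-- An exponential monomial: `f x = P (a₁ x, …, a_k x) * m x`, with `P` a complex polynomial in
`k` variables, `a₁, …, a_k` additive functions and `m` an exponential. -/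
def IsExponentialMonomial (f : C(G, ℂ)) : Prop :=
  ∃ (k : ℕ) (P : MvPolynomial (Fin k) ℂ) (a : Fin k → C(G, ℂ)) (m : C(G, ℂ)),
    (∀ i, IsAdditive (a i)) ∧ IsExponential m ∧
      ∀ x, f x = MvPolynomial.eval (fun i => a i x) P * m x

/-- `V` is synthesizable: the exponential monomials that belong to `V` span a dense subspace
of `V`. -/
def IsSynthesizable (V : Submodule ℂ C(G, ℂ)) : Prop :=
  (Submodule.span ℂ {f : C(G, ℂ) | f ∈ V ∧ IsExponentialMonomial f}).topologicalClosure = V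

end

/-- Spectral synthesis holds on `G`: every variety on `G` is synthesizable. -/
def HasSpectralSynthesis (G : Type*) [AddCommGroup G] [TopologicalSpace G]
    [IsTopologicalAddGroup G] : Prop :=
  ∀ V : Submodule ℂ C(G, ℂ), IsVariety V → IsSynthesizable V

end SpectralSynthesis

/-!
On a compact abelian group every variety is spanned, up to closure, by the exponentials it contains,
so polynomial factors are not needed. Let `μ` be the normalised Haar measure.

The key fact is that every nonzero variety `V` contains an exponential
(`IsVariety.exists_isExponential_mem`). Given `f ≠ 0` in `V`, there is a Hermitian function `h` with
`h * f ≠ 0`. Convolution by `h` is a compact operator on `C(G, ℂ)`, symmetric for the `L²` inner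
product, commutes with translations and maps `V` to itself, since `h * g` is an average of
translates of `g`. Its restriction to `V` has a nonzero eigenvalue; the eigenspace is
finite-dimensional and translation invariant, hence contains a common eigenvector of all
translations, which is an exponential up to a constant.

Applied to the variety of all functions whose Fourier coefficients vanish, this shows that this
variety is zero (`eq_zero_of_fourierCoefficient_eq_zero`). Finally, let `Λ` be a continuous linear
functional vanishing on the exponentials of `V`, and let `f ∈ V`. The Fourier coefficient of
`x ↦ Λ (τ_x f)` at an exponential `m` is the coefficient of `f` at `m` times `Λ m`. If the former is
nonzero, then `m ∈ V`, because this coefficient times `m` is an average of translates of `f`; so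
`Λ m = 0`. Hence `x ↦ Λ (τ_x f)` vanishes, and its value at `0` is `Λ f`. The Hahn–Banach theorem
gives the density.

No separation axiom on `G` is used.
-/

namespace SpectralSynthesis

open MeasureTheory Filter Topology
open scoped ENNReal NNReal ComplexConjugate InnerProductSpace

/-! ### Linear algebra and compact operators -/

theorem exists_common_eigenvector {ι M : Type*} [AddCommGroup M] [Module ℂ M]
    [FiniteDimensional ℂ M] [Nontrivial M] (S : ι → Module.End ℂ M)
    (hS : ∀ i j, Commute (S i) (S j)) : ∃ v : M, v ≠ 0 ∧ ∀ i, ∃ c : ℂ, S i v = c • v := by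
  induction hn : Module.finrank ℂ M using Nat.strong_induction_on generalizing M with
  | _ n ih =>
  subst hn
  by_cases hscal : ∀ i, ∃ c : ℂ, ∀ v, S i v = c • v
  · obtain ⟨v, hv⟩ := exists_ne (0 : M)
    exact ⟨v, hv, fun i => (hscal i).imp fun c hc => hc v⟩
  -- An eigenspace of a non-scalar `S i` is a proper subspace invariant under the whole family.
  push Not at hscal
  obtain ⟨i, hi⟩ := hscal
  obtain ⟨c, hc⟩ := Module.End.exists_eigenvalue (S i)
  set N := Module.End.eigenspace (S i) c with hN
  have hmaps : ∀ j, ∀ v ∈ N, S j v ∈ N := by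
    intro j v hv
    rw [hN, Module.End.mem_eigenspace_iff] at hv ⊢
    have := LinearMap.congr_fun (hS i j).eq v
    simp only [Module.End.mul_apply] at this
    rw [this, hv, map_smul]
  have hlt : Module.finrank ℂ N < Module.finrank ℂ M := by
    refine Submodule.finrank_lt fun htop => ?_
    obtain ⟨v, hv⟩ := hi c
    exact hv (Module.End.mem_eigenspace_iff.1 (htop ▸ Submodule.mem_top : v ∈ N))
  have : Nontrivial N := Submodule.nontrivial_iff_ne_bot.2 hc
  obtain ⟨v, hv, h⟩ := ih _ hlt (fun j => (S j).restrict (hmaps j))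
    (fun j k => LinearMap.ext fun v => Subtype.ext (LinearMap.congr_fun (hS j k).eq v.1)) rfl
  exact ⟨v, by simpa using hv, fun j => (h j).imp fun c hc => congrArg Subtype.val hc⟩

theorem spectralRadius_ne_zero_of_le_norm_pow {A : Type*} [NormedRing A] [NormedAlgebra ℂ A]
    [CompleteSpace A] (a : A) {b c : ℝ} (hb : 0 < b) (hc : 0 < c)
    (h : ∀ n, b * c ^ n ≤ ‖a ^ n‖) : spectralRadius ℂ a ≠ 0 := by
  intro h0
  have ht := spectrum.pow_norm_pow_one_div_tendsto_nhds_spectralRadius a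
  rw [h0] at ht
  have hpos : (0 : ℝ≥0∞) < ENNReal.ofReal (c / 2) := by simpa using hc
  have hgeo : Tendsto (fun n : ℕ => (1 / 2 : ℝ) ^ n) atTop (𝓝 0) :=
    tendsto_pow_atTop_nhds_zero_of_lt_one (by norm_num) (by norm_num)
  obtain ⟨n, ⟨hn, hn'⟩, hn0⟩ := ((ht.eventually (gt_mem_nhds hpos)).and
    (hgeo.eventually (gt_mem_nhds hb))).and (eventually_ne_atTop 0) |>.exists
  rw [ENNReal.ofReal_lt_ofReal_iff (by positivity)] at hn
  have h1 : ‖a ^ n‖ < (c / 2) ^ n := by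
    have := pow_lt_pow_left₀ hn (by positivity) hn0
    rwa [one_div, Real.rpow_inv_natCast_pow (norm_nonneg _) hn0] at this
  have h2 : (c / 2) ^ n = (1 / 2) ^ n * c ^ n := by rw [← mul_pow]; ring
  have h3 : (0 : ℝ) < c ^ n := by positivity
  nlinarith [h n]

/-- A compact operator on a Banach space that is symmetric for the semi-inner product pulled back
along `J`, and nonzero for the associated seminorm, has a nonzero eigenvalue: its spectral radius
is positive by Gelfand's formula, and the Fredholm alternative applies. The seminorm need not be
complete. -/
theorem hasEigenvalue_of_isCompactOperator_of_symmetric {X H : Type*} [NormedAddCommGroup X]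
    [NormedSpace ℂ X] [CompleteSpace X] [NormedAddCommGroup H] [InnerProductSpace ℂ H]
    (T : X →L[ℂ] X) (hT : IsCompactOperator T) (J : X →L[ℂ] H)
    (hsymm : ∀ x y, ⟪J (T x), J y⟫_ℂ = ⟪J x, J (T y)⟫_ℂ) {x : X} (hx : J (T x) ≠ 0) :
    ∃ c : ℂ, c ≠ 0 ∧ Module.End.HasEigenvalue (T : Module.End ℂ X) c := by
  have hsq : ∀ y, ‖J (T y)‖ ^ 2 ≤ ‖J y‖ * ‖J (T (T y))‖ := by
    intro y
    have h : (‖J (T y)‖ : ℂ) ^ 2 = ⟪J y, J (T (T y))⟫_ℂ := by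
      rw [← hsymm, inner_self_eq_norm_sq_to_K]; rfl
    calc ‖J (T y)‖ ^ 2 = ‖(‖J (T y)‖ : ℂ) ^ 2‖ := by simp
      _ ≤ _ := by rw [h]; exact norm_inner_le_norm _ _
  have h1 : 0 < ‖J (T x)‖ := norm_pos_iff.2 hx
  have h0 : 0 < ‖J x‖ := by
    refine lt_of_le_of_ne (norm_nonneg _) fun h => ?_
    have := hsq x
    rw [← h, zero_mul] at this
    nlinarith
  set c := ‖J (T x)‖ / ‖J x‖ with hc
  have hcpos : 0 < c := by positivity
  -- The symmetry of `T` makes the ratios `‖J Tⁿ⁺¹ x‖ / ‖J Tⁿ x‖` nondecreasing.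
  have hratio : ∀ n, 0 < ‖J ((T ^ n) x)‖ ∧ c * ‖J ((T ^ n) x)‖ ≤ ‖J ((T ^ (n + 1)) x)‖ := by
    intro n
    induction n with
    | zero => exact ⟨by simpa using h0, by simp [hc, h0.ne']⟩
    | succ n ih =>
      have hpos : 0 < ‖J ((T ^ (n + 1)) x)‖ := lt_of_lt_of_le (mul_pos hcpos ih.1) ih.2
      refine ⟨hpos, ?_⟩
      have := hsq ((T ^ n) x)
      simp only [pow_succ', mul_apply_eq_comp] at this hpos ih ⊢
      refine le_of_mul_le_mul_left ?_ ih.1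
      nlinarith
  have hgrow : ∀ n, ‖J x‖ * c ^ n ≤ ‖J ((T ^ n) x)‖ := by
    intro n
    induction n with
    | zero => simp
    | succ n ih =>
      calc ‖J x‖ * c ^ (n + 1) = c * (‖J x‖ * c ^ n) := by ring
        _ ≤ c * ‖J ((T ^ n) x)‖ := by gcongr
        _ ≤ _ := (hratio n).2
  have hM : 0 < ‖J‖ * ‖x‖ := h0.trans_le (J.le_opNorm x)
  have hr := spectralRadius_ne_zero_of_le_norm_pow T (div_pos h0 hM) hcpos fun n => by
    rw [div_mul_eq_mul_div, div_le_iff₀ hM]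
    calc ‖J x‖ * c ^ n ≤ ‖J ((T ^ n) x)‖ := hgrow n
      _ ≤ ‖J‖ * (‖T ^ n‖ * ‖x‖) := J.le_opNorm_of_le ((T ^ n).le_opNorm x)
      _ = _ := by ring
  have : Nontrivial X := ⟨x, 0, fun h => by simp [h] at h0⟩
  obtain ⟨z, hz, hzr⟩ := spectrum.exists_nnnorm_eq_spectralRadius T
  have hz0 : z ≠ 0 := by
    rintro rfl
    exact hr (by rw [← hzr]; simp)
  exact ⟨z, hz0, (hT.hasEigenvalue_iff_mem_spectrum hz0).2 hz⟩

theorem finiteDimensional_of_isCompactOperator_eq_smul {X : Type*} [NormedAddCommGroup X]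
    [NormedSpace ℂ X] (T : X →L[ℂ] X) (hT : IsCompactOperator T) {E : Submodule ℂ X}
    (hE : IsClosed (E : Set X)) {c : ℂ} (hc : c ≠ 0) (h : ∀ x ∈ E, T x = c • x) :
    FiniteDimensional ℂ E := by
  have hmaps : ∀ x ∈ E, (T : X →ₗ[ℂ] X) x ∈ E := fun x hx => by
    simpa [h x hx] using E.smul_mem c hx
  have hcomp : IsCompactOperator ((T : X →ₗ[ℂ] X).restrict hmaps) :=
    IsCompactOperator.restrict (f := (T : X →ₗ[ℂ] X)) hT hmaps hE
  refine FiniteDimensional.of_isCompactOperator_id (𝕜 := ℂ) ?_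
  have hid : (id : E → E) = c⁻¹ • ⇑((T : X →ₗ[ℂ] X).restrict hmaps) := by
    funext x
    exact Subtype.ext (by simp [h x x.2, hc])
  rw [hid]
  exact hcomp.smul c⁻¹

/-! ### Integration of continuous families -/

section Integral

variable {X E : Type*} [TopologicalSpace X] [CompactSpace X] [MeasurableSpace X] [BorelSpace X]
  [NormedAddCommGroup E]

theorem integrable_continuousMap (μ : Measure X) [IsFiniteMeasure μ] {u : X → E}
    (hu : Continuous u) : Integrable u μ :=
  hu.integrable_of_hasCompactSupport (HasCompactSupport.of_compactSpace u)

variable [NormedSpace ℂ E]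

theorem integral_mem_of_isClosed (μ : Measure X) [IsProbabilityMeasure μ] [CompleteSpace E]
    {V : Submodule ℂ E} (hV : IsClosed (V : Set E)) {u : X → E} (hu : Continuous u)
    (h : ∀ x, u x ∈ V) : ∫ x, u x ∂μ ∈ V :=
  Convex.integral_mem (V.restrictScalars ℝ).convex hV (Eventually.of_forall h)
    (integrable_continuousMap μ hu)

/-- The operator `f ↦ ∫ f(y) k(y) dμ(y)` attached to a continuous family `k` of vectors. -/
noncomputable def integralOperator (μ : Measure X) [IsProbabilityMeasure μ] (k : C(X, E)) :
    C(X, ℂ) →L[ℂ] E :=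
  LinearMap.mkContinuous
    { toFun := fun f => ∫ y, f y • k y ∂μ
      map_add' := fun f g => by
        simp only [ContinuousMap.add_apply, add_smul]
        exact integral_add (integrable_continuousMap μ (by fun_prop))
          (integrable_continuousMap μ (by fun_prop))
      map_smul' := fun c f => by
        simp only [ContinuousMap.smul_apply, smul_assoc, integral_smul, RingHom.id_apply] }
    ‖k‖ fun f => by
      refine (norm_integral_le_of_norm_le_const (μ := μ) (C := ‖k‖ * ‖f‖)
        (Eventually.of_forall fun y => ?_)).trans (by simp)
      rw [norm_smul, mul_comm]
      exact mul_le_mul (k.norm_coe_le_norm y) (f.norm_coe_le_norm y) (norm_nonneg _)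
        (norm_nonneg _)

theorem integralOperator_apply (μ : Measure X) [IsProbabilityMeasure μ] (k : C(X, E))
    (f : C(X, ℂ)) : integralOperator μ k f = ∫ y, f y • k y ∂μ := rfl

/-- The image of the unit ball lies in the closed absolutely convex hull of a compact set. -/
theorem isCompactOperator_integralOperator [CompleteSpace E] (μ : Measure X)
    [IsProbabilityMeasure μ] (k : C(X, E)) : IsCompactOperator (integralOperator μ k) := by
  let K : Set E := (fun p : ℂ × X => p.1 • k p.2) '' (Metric.closedBall 0 1 ×ˢ Set.univ)
  have hK : IsCompact K :=
    ((isCompact_closedBall _ _).prod isCompact_univ).image (by fun_prop)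
  have hK' : IsCompact (closedAbsConvexHull ℝ K) :=
    isCompact_closedAbsConvexHull_of_totallyBounded hK.totallyBounded
  refine (isCompactOperator_iff_image_closedBall_subset_compact (𝕜₁ := ℂ) (σ₁₂ := RingHom.id ℂ)
    (integralOperator μ k : C(X, ℂ) →ₗ[ℂ] E) one_pos).2 ⟨_, hK', ?_⟩
  rintro _ ⟨f, hf, rfl⟩
  refine Convex.integral_mem absConvex_convexClosedHull.2
    isClosed_closedAbsConvexHull (Eventually.of_forall fun y => ?_)
    (integrable_continuousMap μ (by fun_prop))
  refine subset_closedAbsConvexHull ⟨(f y, y), ⟨?_, trivial⟩, rfl⟩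
  simp only [mem_closedBall_zero_iff] at hf ⊢
  exact (f.norm_coe_le_norm y).trans hf

end Integral

/-! ### Translations and convolution -/

section Group

variable {G : Type*} [AddCommGroup G] [TopologicalSpace G]

theorem IsExponential.map_zero {m : C(G, ℂ)} (hm : IsExponential m) : m 0 = 1 := by
  have h := hm.map_add 0 0
  rw [add_zero] at h
  exact (mul_eq_left₀ (hm.ne_zero 0)).1 h.symm

theorem IsExponential.mul_neg {m : C(G, ℂ)} (hm : IsExponential m) (x : G) :
    m x * m (-x) = 1 := by
  rw [← hm.map_add, add_neg_cancel, hm.map_zero]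

theorem IsExponential.isExponentialMonomial {m : C(G, ℂ)} (hm : IsExponential m) :
    IsExponentialMonomial m :=
  ⟨0, 1, Fin.elim0, m, fun i => i.elim0, hm, by simp⟩

variable [IsTopologicalAddGroup G]

@[simp]
theorem translateMap_apply (y : G) (f : C(G, ℂ)) (x : G) : translateMap y f x = f (x + y) := rfl

/-- Translation by `y` as a linear endomorphism of `C(G, ℂ)`. -/
noncomputable def translateLinear (y : G) : Module.End ℂ C(G, ℂ) where
  toFun := translateMap y
  map_add' _ _ := rfl
  map_smul' _ _ := rfl

@[simp]
theorem translateLinear_apply (y : G) (f : C(G, ℂ)) : translateLinear y f = translateMap y f := rfl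

/-- The orbit map `y ↦ τ_y f` as a continuous map into `C(G, ℂ)`. -/
noncomputable def orbitMap (f : C(G, ℂ)) : C(G, C(G, ℂ)) :=
  ContinuousMap.curry ⟨fun p : G × G => f (p.2 + p.1), by fun_prop⟩

@[simp]
theorem orbitMap_apply (f : C(G, ℂ)) (y : G) : orbitMap f y = translateMap y f := rfl

/-- The reflection `x ↦ f (-x)`. -/
noncomputable def reflect (f : C(G, ℂ)) : C(G, ℂ) := ⟨fun x => f (-x), by fun_prop⟩

@[simp]
theorem reflect_apply (f : C(G, ℂ)) (x : G) : reflect f x = f (-x) := rfl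

/-- A common eigenvector of all translations is an exponential up to a constant factor. -/
theorem isExponential_of_translateMap_eq_smul {w : C(G, ℂ)} (hw : w ≠ 0)
    (h : ∀ y, ∃ c : ℂ, translateMap y w = c • w) :
    IsExponential ((w 0)⁻¹ • w) := by
  choose c hc using h
  have hw' : ∀ x y, w (x + y) = c y * w x := fun x y => by
    simpa using DFunLike.congr_fun (hc y) x
  have h0 : w 0 ≠ 0 := by
    intro h0
    refine hw (ContinuousMap.ext fun x => ?_)
    simpa [h0] using hw' 0 x
  have hmul : ∀ x y, ((w 0)⁻¹ • w) (x + y) = ((w 0)⁻¹ • w) x * ((w 0)⁻¹ • w) y := by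
    intro x y
    have := hw' 0 y
    rw [zero_add] at this
    simp only [ContinuousMap.smul_apply, smul_eq_mul, hw' x y, this]
    field_simp
  refine ⟨fun x hx => ?_, hmul⟩
  have := hmul x (-x)
  rw [hx, zero_mul, add_neg_cancel] at this
  simp [h0] at this

variable [CompactSpace G] [MeasurableSpace G] [BorelSpace G]

section Convolution

/-- The convolution operator `f ↦ ∫ f(y) h(· - y) dμ(y)`, as the integral of the continuous family
of translates of `h`. -/
noncomputable def convolution (μ : Measure G) [IsProbabilityMeasure μ] (h : C(G, ℂ)) :
    C(G, ℂ) →L[ℂ] C(G, ℂ) :=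
  integralOperator μ ((orbitMap h).comp ⟨fun y => -y, by fun_prop⟩)

variable (μ : Measure G) [IsProbabilityMeasure μ]

theorem integral_smul_translateMap_apply (g f : C(G, ℂ)) (x : G) :
    (∫ y, g y • translateMap y f ∂μ) x = ∫ y, g y * f (x + y) ∂μ := by
  have hi : Integrable (fun y => g y • orbitMap f y) μ := integrable_continuousMap μ (by fun_prop)
  exact ((ContinuousMap.evalCLM ℂ x : C(G, ℂ) →L[ℂ] ℂ).integral_comp_comm hi).symm

theorem convolution_apply (h f : C(G, ℂ)) (x : G) :
    convolution μ h f x = ∫ y, f y * h (x - y) ∂μ := by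
  have hi : Integrable (fun y => f y • orbitMap h (-y)) μ :=
    integrable_continuousMap μ (by fun_prop)
  have := (ContinuousMap.evalCLM ℂ x : C(G, ℂ) →L[ℂ] ℂ).integral_comp_comm hi
  simpa [convolution, integralOperator_apply, sub_eq_add_neg] using this.symm

theorem isCompactOperator_convolution (h : C(G, ℂ)) : IsCompactOperator (convolution μ h) :=
  isCompactOperator_integralOperator μ _

theorem integral_smul_translateMap_mem {V : Submodule ℂ C(G, ℂ)} (hV : IsVariety V)
    (g : C(G, ℂ)) {f : C(G, ℂ)} (hf : f ∈ V) : ∫ y, g y • translateMap y f ∂μ ∈ V := by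
  have hc : Continuous fun y => g y • orbitMap f y := by fun_prop
  exact integral_mem_of_isClosed μ hV.isClosed hc
    fun y => V.smul_mem _ (hV.translate_mem y f hf)

/-- Convolution by `h` also averages translates of `f`. This is why it preserves varieties, whereas
its definition through translates of `h` is what makes it compact. -/
theorem convolution_eq_integral_translateMap [μ.IsAddLeftInvariant] (h f : C(G, ℂ)) :
    convolution μ h f = ∫ y, reflect h y • translateMap y f ∂μ := by
  ext x
  rw [convolution_apply, integral_smul_translateMap_apply,
    ← integral_add_left_eq_self (μ := μ) _ x]
  refine integral_congr_ae (Eventually.of_forall fun y => ?_)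
  simp [mul_comm]

theorem convolution_mem [μ.IsAddLeftInvariant] {V : Submodule ℂ C(G, ℂ)}
    (hV : IsVariety V) (h : C(G, ℂ)) {f : C(G, ℂ)} (hf : f ∈ V) : convolution μ h f ∈ V := by
  rw [convolution_eq_integral_translateMap]
  exact integral_smul_translateMap_mem μ hV _ hf

theorem convolution_translateMap [μ.IsAddLeftInvariant] (h f : C(G, ℂ)) (z : G) :
    convolution μ h (translateMap z f) = translateMap z (convolution μ h f) := by
  ext x
  rw [translateMap_apply, convolution_apply, convolution_apply,
    ← integral_add_left_eq_self (μ := μ) (fun y => f y * h (x + z - y)) z]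
  refine integral_congr_ae (Eventually.of_forall fun y => ?_)
  simp only [translateMap_apply]
  rw [add_comm z y, add_sub_add_right_eq_sub]

/-- Convolution by a Hermitian function is symmetric for the `L²` inner product. -/
theorem inner_toLp_convolution {h : C(G, ℂ)} (hh : ∀ x, h (-x) = conj (h x)) (f g : C(G, ℂ)) :
    ⟪ContinuousMap.toLp 2 μ ℂ (convolution μ h f), ContinuousMap.toLp 2 μ ℂ g⟫_ℂ =
      ⟪ContinuousMap.toLp 2 μ ℂ f, ContinuousMap.toLp 2 μ ℂ (convolution μ h g)⟫_ℂ := by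
  let L := (innerSL ℂ (ContinuousMap.toLp 2 μ ℂ f)).comp (ContinuousMap.toLp 2 μ ℂ)
  have hi : Integrable (fun y => g y • orbitMap h (-y)) μ :=
    integrable_continuousMap μ (by fun_prop)
  -- Pulling the functional `⟪f, ·⟫` inside the vector-valued integral replaces Fubini's theorem.
  have hL : ⟪ContinuousMap.toLp 2 μ ℂ f, ContinuousMap.toLp 2 μ ℂ (convolution μ h g)⟫_ℂ =
      ∫ y, L (g y • orbitMap h (-y)) ∂μ := (L.integral_comp_comm hi).symm
  rw [hL, ContinuousMap.inner_toLp]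
  refine integral_congr_ae (Eventually.of_forall fun y => ?_)
  simp only [map_smul, smul_eq_mul]
  congr 1
  change _ = ⟪ContinuousMap.toLp 2 μ ℂ f, ContinuousMap.toLp 2 μ ℂ (orbitMap h (-y))⟫_ℂ
  rw [ContinuousMap.inner_toLp, convolution_apply, ← integral_conj]
  refine integral_congr_ae (Eventually.of_forall fun x => ?_)
  simp only [map_mul, orbitMap_apply, translateMap_apply, ← hh]
  rw [mul_comm, neg_sub, sub_eq_add_neg]

/-- Convolution by `x ↦ conj (f (-x))` takes `f` to a function whose value at `0` is `‖f‖²` in `L²`,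
and every function is a combination of Hermitian ones. -/
theorem exists_hermitian_convolution_ne_zero [μ.IsOpenPosMeasure] {f : C(G, ℂ)} (hf : f ≠ 0) :
    ∃ h : C(G, ℂ), (∀ x, h (-x) = conj (h x)) ∧ convolution μ h f ≠ 0 := by
  by_contra! H
  let k : C(G, ℂ) := star (reflect f)
  have hk : ∀ x, k x = conj (f (-x)) := fun _ => rfl
  -- `k` is the combination of the Hermitian functions `k + f` and `I • (k - f)`.
  have h1 := H (k + f) fun x => by simp [hk, add_comm]
  have h2 := H (Complex.I • (k - f)) fun x => by simp [hk]; ring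
  have e1 := DFunLike.congr_fun h1 0
  have e2 := DFunLike.congr_fun h2 0
  simp only [convolution_apply, zero_sub, ContinuousMap.add_apply, ContinuousMap.smul_apply,
    ContinuousMap.sub_apply, ContinuousMap.zero_apply, hk, neg_neg] at e1 e2
  have i1 : Integrable (fun y => f y * conj (f y)) μ := integrable_continuousMap μ (by fun_prop)
  have i2 : Integrable (fun y => f y * f (-y)) μ := integrable_continuousMap μ (by fun_prop)
  have e3 : ∫ y, f y * conj (f y) ∂μ + ∫ y, f y * f (-y) ∂μ = 0 := by
    rw [← integral_add i1 i2, ← e1]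
    simp only [mul_add]
  have e4 : Complex.I * (∫ y, f y * conj (f y) ∂μ - ∫ y, f y * f (-y) ∂μ) = 0 := by
    rw [← integral_sub i1 i2, ← integral_const_mul, ← e2]
    refine integral_congr_ae (Eventually.of_forall fun y => ?_)
    simp only [smul_eq_mul]; ring
  have e5 : ∫ y, f y * conj (f y) ∂μ = 0 := by
    have := (mul_eq_zero.1 e4).resolve_left Complex.I_ne_zero
    linear_combination (e3 + this) / 2
  rw [← ContinuousMap.inner_toLp, inner_self_eq_zero] at e5
  exact hf (ContinuousMap.toLp_injective (p := 2) (𝕜 := ℂ) μ (by rw [e5, map_zero]))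

end Convolution

/-! ### Exponentials in varieties -/

/-- A nonzero eigenspace of a compact convolution operator on `V` is finite-dimensional and
translation invariant, so the commuting translations have a common eigenvector in it. -/
theorem IsVariety.exists_isExponential_mem (μ : Measure G) [IsProbabilityMeasure μ]
    [μ.IsAddLeftInvariant] [μ.IsOpenPosMeasure]
    {V : Submodule ℂ C(G, ℂ)} (hV : IsVariety V) (hV0 : V ≠ ⊥) : ∃ m ∈ V, IsExponential m := by
  obtain ⟨f, hfV, hf⟩ := Submodule.exists_mem_ne_zero_of_ne_bot hV0
  obtain ⟨h, hh, hhf⟩ := exists_hermitian_convolution_ne_zero μ hf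
  set T := convolution μ h with hT
  have hTc : IsCompactOperator T := isCompactOperator_convolution μ h
  have hTV : ∀ g ∈ V, T g ∈ V := fun g hg => convolution_mem μ hV h hg
  have : CompleteSpace V := hV.isClosed.completeSpace_coe
  let TV : V →L[ℂ] V := (T.comp V.subtypeL).codRestrict V fun g => hTV g g.2
  have hTVc : IsCompactOperator TV :=
    (hTc.comp_clm V.subtypeL).codRestrict (fun g => hTV g g.2) hV.isClosed
  obtain ⟨c, hc, hcT⟩ := hasEigenvalue_of_isCompactOperator_of_symmetric TV hTVc
    ((ContinuousMap.toLp 2 μ ℂ).comp V.subtypeL)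
    (fun x y => inner_toLp_convolution μ hh x.1 y.1) (x := ⟨f, hfV⟩) fun h0 =>
      hhf (ContinuousMap.toLp_injective (p := 2) (𝕜 := ℂ) μ (h0.trans (map_zero _).symm))
  obtain ⟨u, hu⟩ := hcT.exists_hasEigenvector
  let N : Submodule ℂ C(G, ℂ) := V ⊓ (T - c • ContinuousLinearMap.id ℂ _).ker
  have hmem : ∀ g, g ∈ N ↔ g ∈ V ∧ T g = c • g := fun g => by
    simp [N, LinearMap.mem_ker, sub_eq_zero]
  have hNc : IsClosed (N : Set C(G, ℂ)) :=
    hV.isClosed.inter (ContinuousLinearMap.isClosed_ker _)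
  have : FiniteDimensional ℂ N :=
    finiteDimensional_of_isCompactOperator_eq_smul T hTc hNc hc fun g hg => ((hmem g).1 hg).2
  have : Nontrivial N := by
    refine ⟨⟨⟨u.1, (hmem _).2 ⟨u.2, ?_⟩⟩, 0, fun h0 => hu.2 ?_⟩⟩
    · exact congrArg Subtype.val hu.apply_eq_smul
    · exact Subtype.ext (congrArg (fun v : N => (v : C(G, ℂ))) h0)
  have hNt : ∀ y : G, ∀ g ∈ N, translateLinear y g ∈ N := by
    intro y g hg
    rw [hmem] at hg ⊢
    refine ⟨hV.translate_mem y g hg.1, ?_⟩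
    rw [translateLinear_apply, hT, convolution_translateMap, ← hT, hg.2]
    rfl
  obtain ⟨w, hw, hwt⟩ := exists_common_eigenvector
    (fun y : G => (translateLinear y).restrict (hNt y))
    (fun y z => LinearMap.ext fun g => Subtype.ext <| ContinuousMap.ext fun x =>
      congrArg g.1 (add_right_comm x y z))
  refine ⟨_, V.smul_mem (w.1 0)⁻¹ ((hmem _).1 w.2).1,
    isExponential_of_translateMap_eq_smul (by simpa using hw) fun y => ?_⟩
  exact (hwt y).imp fun c hc => congrArg Subtype.val hc

/-- The pairing `∫ f(x) m(-x) dμ(x)`; for an exponential `m` it is the Fourier coefficient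
of `f` at `m`. -/
noncomputable def fourierCoefficient (μ : Measure G) [IsProbabilityMeasure μ] (m : C(G, ℂ)) :
    C(G, ℂ) →L[ℂ] ℂ :=
  integralOperator μ (reflect m)

/-- Uniqueness of Fourier coefficients: the functions all of whose coefficients vanish form a
variety, and an exponential `m` is not among them because its coefficient at `m` is `1`. -/
theorem eq_zero_of_fourierCoefficient_eq_zero (μ : Measure G) [IsProbabilityMeasure μ]
    [μ.IsAddLeftInvariant] [μ.IsOpenPosMeasure]
    {f : C(G, ℂ)}
    (hf : ∀ m, IsExponential m → fourierCoefficient μ m f = 0) : f = 0 := by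
  let V : Submodule ℂ C(G, ℂ) :=
    ⨅ m : {m : C(G, ℂ) // IsExponential m}, (fourierCoefficient μ m.1).ker
  have hmem : ∀ g, g ∈ V ↔ ∀ m, IsExponential m → fourierCoefficient μ m g = 0 := fun g => by
    simp [V, Submodule.mem_iInf]
  have hV : IsVariety V := by
    refine ⟨?_, fun y g hg => (hmem _).2 fun m hm => ?_⟩
    · simp only [V, Submodule.coe_iInf]
      exact isClosed_iInter fun m => ContinuousLinearMap.isClosed_ker _
    · have hgm := (hmem _).1 hg m hm
      simp only [fourierCoefficient, integralOperator_apply, reflect_apply, smul_eq_mul,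
        translateMap_apply] at hgm ⊢
      rw [← integral_add_right_eq_self (μ := μ) _ y] at hgm
      rw [← mul_zero (m y), ← hgm, ← integral_const_mul]
      refine integral_congr_ae (Eventually.of_forall fun x => ?_)
      simp only [neg_add, hm.map_add]
      linear_combination (-g (x + y) * m (-x)) * hm.mul_neg y
  by_contra hf0
  obtain ⟨m, hmV, hm⟩ := hV.exists_isExponential_mem μ
    ((Submodule.ne_bot_iff V).2 ⟨f, (hmem f).2 hf, hf0⟩)
  have := (hmem m).1 hmV m hm
  simp [fourierCoefficient, integralOperator_apply, hm.mul_neg] at this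

theorem integral_smul_translateMap_reflect (μ : Measure G) [IsProbabilityMeasure μ]
    [μ.IsAddLeftInvariant] {m : C(G, ℂ)} (hm : IsExponential m) (f : C(G, ℂ)) :
    ∫ y, reflect m y • translateMap y f ∂μ = fourierCoefficient μ m f • m := by
  ext z
  rw [integral_smul_translateMap_apply]
  simp only [ContinuousMap.smul_apply, fourierCoefficient, integralOperator_apply, smul_eq_mul,
    reflect_apply]
  rw [← integral_add_left_eq_self (μ := μ) (fun y => f y * m (-y)) z, mul_comm,
    ← integral_const_mul]
  refine integral_congr_ae (Eventually.of_forall fun y => ?_)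
  simp only [neg_add, hm.map_add]
  linear_combination (-f (z + y) * m (-y)) * hm.mul_neg z

/-- An exponential occurring in the Fourier expansion of an element of `V` lies in `V`. -/
theorem IsVariety.mem_of_fourierCoefficient_ne_zero (μ : Measure G) [IsProbabilityMeasure μ]
    [μ.IsAddLeftInvariant]
    {V : Submodule ℂ C(G, ℂ)} (hV : IsVariety V) {f m : C(G, ℂ)} (hf : f ∈ V)
    (hm : IsExponential m) (h : fourierCoefficient μ m f ≠ 0) :
    m ∈ V := by
  have := integral_smul_translateMap_mem μ hV (reflect m) hf
  rw [integral_smul_translateMap_reflect μ hm] at this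
  exact (V.smul_mem_iff h).1 this

theorem IsVariety.le_topologicalClosure_span_isExponential (μ : Measure G) [IsProbabilityMeasure μ]
    [μ.IsAddLeftInvariant] [μ.IsOpenPosMeasure]
    {V : Submodule ℂ C(G, ℂ)} (hV : IsVariety V) :
    V ≤ (Submodule.span ℂ {m : C(G, ℂ) | m ∈ V ∧ IsExponential m}).topologicalClosure := by
  intro f hf
  set W := (Submodule.span ℂ {m : C(G, ℂ) | m ∈ V ∧ IsExponential m}).topologicalClosure with hW
  by_contra hfW
  have : IsClosed (W : Set C(G, ℂ)) := Submodule.isClosed_topologicalClosure _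
  obtain ⟨L, hL⟩ := SeparatingDual.exists_ne_zero (R := ℂ) (x := W.mkQL f)
    (by simpa using hfW)
  let Λ : C(G, ℂ) →L[ℂ] ℂ := L.comp W.mkQL
  have hΛ : ∀ m ∈ V, IsExponential m → Λ m = 0 := fun m hmV hm => by
    have hmW : m ∈ W := Submodule.le_topologicalClosure _ (Submodule.subset_span ⟨hmV, hm⟩)
    have : W.mkQL m = 0 := by simpa using hmW
    simp [Λ, this]
  -- The Fourier coefficients of `F` are those of `f` multiplied by the values of `Λ` at the
  -- exponentials, and one of the two factors always vanishes.
  let F : C(G, ℂ) := ⟨fun x => Λ (orbitMap f x), by fun_prop⟩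
  have hF : F = 0 := by
    refine eq_zero_of_fourierCoefficient_eq_zero μ fun m hm => ?_
    have hi : Integrable (fun y => reflect m y • orbitMap f y) μ :=
      integrable_continuousMap μ (by fun_prop)
    have h1 : fourierCoefficient μ m F = Λ (∫ y, reflect m y • translateMap y f ∂μ) := by
      refine Eq.trans ?_ (Λ.integral_comp_comm hi)
      rw [fourierCoefficient, integralOperator_apply]
      refine integral_congr_ae (Eventually.of_forall fun y => ?_)
      simp only [map_smul, smul_eq_mul, F, ContinuousMap.coe_mk]
      rw [mul_comm, orbitMap_apply]
    rw [h1, integral_smul_translateMap_reflect μ hm, map_smul, smul_eq_mul]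
    by_cases h : fourierCoefficient μ m f = 0
    · rw [h, zero_mul]
    · rw [hΛ m (hV.mem_of_fourierCoefficient_ne_zero μ hf hm h) hm, mul_zero]
  have h0 : Λ (translateMap 0 f) = 0 := DFunLike.congr_fun hF 0
  have : translateMap 0 f = f := by ext; simp
  rw [this] at h0
  exact hL h0

end Group

end SpectralSynthesis

theorem mainTheorem7 (G : Type*) [AddCommGroup G] [TopologicalSpace G] [IsTopologicalAddGroup G]
    [CompactSpace G] : SpectralSynthesis.HasSpectralSynthesis G := by
  intro V hV
  borelize G
  let K : TopologicalSpace.PositiveCompacts G := ⊤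
  have : MeasureTheory.IsProbabilityMeasure (MeasureTheory.Measure.addHaarMeasure K) :=
    ⟨MeasureTheory.Measure.addHaarMeasure_self (K₀ := K)⟩
  refine le_antisymm (Submodule.topologicalClosure_minimal _
    (Submodule.span_le.2 fun f hf => hf.1) hV.isClosed) ?_
  refine (hV.le_topologicalClosure_span_isExponential
    (MeasureTheory.Measure.addHaarMeasure K)).trans (Submodule.topologicalClosure_mono
      (Submodule.span_mono fun m hm => ⟨hm.1, hm.2.isExponentialMonomial⟩))
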